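/- **Conventions.** $\mathbb N=\{0,1,2,\dots\}$, $\mathbb Z_+=\{1,2,\dots\}$. A CAT(0) space is a geodesic metric space $(X,d)$ such that $d(z,m)^2\le\frac12d(z,x)^2+\frac12d(z,y)^2-\frac14d(x,y)^2$ for all $x,y,z,m\in X$ with $d(x,m)=d(y,m)=\frac12d(x,y)$. For $x,y\in X$ and $t\in[0,1]$, $(1-t)x\oplus ty$ denotes the unique point $m$ with $d(x,m)=t\,d(x,y)$ and $d(y,m)=(1-t)\,d(x,y)$; $C\subseteq X$ is convex if it contains all these points for $x,y\in C$. A function $\gamma:(0,\infty)\to\mathbb Z_+$ is a rate of convergence of $(a_n)_{n\ge1}$ towards $a$ if $|a_n-a|\le\delta$ for all $\delta>0$ and $n\ge\gamma(\delta)$, and a Cauchy modulus of $(a_n)_{n\ge 1}$ if $a_{\gamma(\delta)+n}-a_{\gamma(\delta)}\le\delta$ for all $\delta>0$ and $n\in\mathbb N$. **Theorem.** Let $X$ be a complete CAT(0) space, $C\subseteq X$ a closed bounded convex subset with diameter $d_C$, $T:C\to C$ nonexpansive, and $u,x\in C$. Let $(\lambda_n)_{n\ge1}$ be a sequence in $[0,1]$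 with $\lambda_n\in(0,1)$ for all $n\ge2$ such that - (C1) $\lim_{n\to\infty}\lambda_n=0$; - (C2) $\sum_{n=1}^\infty|\lambda_{n+1}-\lambda_n|$ converges; - (C4) $\prod_{n=1}^\infty(1-\lambda_{n+1})=0$, i.e. the partial products $\prod_{i=1}^n(1-\lambda_{i+1})$ tend to $0$. Then the Halpern iteration $x_0:=x$, $x_{n+1}:=\lambda_{n+1}u\oplus(1-\lambda_{n+1})Tx_n$ is a Cauchy sequence. Furthermore, let $M\in\mathbb Z_+$ with $M\ge d_C$, let $\alpha$ be a rate of convergence of $(\lambda_n)$ towards $0$, $\beta$ a Cauchy modulus of $s_n:=\sum_{i=1}^n|\lambda_{i+1}-\lambda_i|$, and $\theta$ a rate of convergence of $\left(\prod_{i=1}^n(1-\lambda_{i+1})\right)_{n\ge 1}$ towards $0$. Let $D(\delta)$ and $D_k(\delta)$ ($\delta>0$, $k\in\mathbb N$) be real numbers such that $$0<D(\delta)\le\prod_{n=1}^{\beta(\delta/(4M))}(1-\lambda_{n+1}),\qquad 0<D_k(\delta)\le\prod_{n=1}^{\chi^*_k(\delta/3)-1}(1-\lambda_{n+1}),$$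 where $$\tilde\Phi(\delta)=\theta\!\left(\frac{D(\delta)\,\delta}{2M}\right)+1,\qquad \Phi(\delta)=\max\left\{\theta\!\left(\frac{D(\delta)\,\delta}{4M}\right)+1,\ \alpha\!\left(\frac{\delta}{4M}\right)\right\},$$ $$\tilde P_k(\delta)=\left\lceil\frac{12M^2(k+1)}{\delta}\,\Phi\!\left(\frac{\delta}{12M(k+1)}\right)\right\rceil,\qquad \chi^*_k(\delta)=\tilde\Phi\!\left(\frac{\delta}{4M(\tilde P_k(\delta/2)+1)}\right)+\tilde P_k(\delta/2).$$ Then for all $\varepsilon\in(0,2)$ and all $g:\mathbb N\to\mathbb N$, $$\exists N\le\Sigma\ \ \forall m,n\in[N,N+g(N)]\ \ \bigl(d(x_n,x_m)\le\varepsilon\bigr),$$ where $$\Sigma=\max\left\{\Theta_k(\varepsilon^2/4)\ \middle|\ \left\lceil\frac1{\varepsilon_0}\right\rceil\le k\le\widetilde{f^*}^{(\lceil M^2/\varepsilon_0^2\rceil)}(0)+\left\lceil\frac1{\varepsilon_0}\right\rceil\right\},\qquad \varepsilon_0=\frac{\varepsilon^2}{24(M+1)^2},$$ $h^{(i)}$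 is the $i$-fold iterate of $h$, and $$\Theta_k(\delta)=\theta\!\left(\frac{D_k(\delta)\,\delta}{3M^2}\right)+1,\qquad \Delta^*_k(\delta,g)=\frac{\delta}{3\,g_{\delta,k}\bigl(\Theta_k(\delta)-\chi^*_k(\delta/3)\bigr)},\qquad g_{\delta,k}(n)=n+g\bigl(n+\chi^*_k(\delta/3)\bigr),$$ $$f(k)=\max\left\{\left\lceil\frac{M^2}{\Delta^*_k(\varepsilon^2/4,g)}\right\rceil,k\right\}-k,\qquad f^*(k)=f\!\left(k+\left\lceil\frac1{\varepsilon_0}\right\rceil\right)+\left\lceil\frac1{\varepsilon_0}\right\rceil,\qquad \widetilde{f^*}(k)=k+f^*(k).$$ (For $\delta=\varepsilon^2/4$ one has $\Theta_k(\delta)>\chi^*_k(\delta/3)$, so $\Delta^*_k(\delta,g)$ is well defined and positive.) -/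

import Mathlib

namespace HalpernCAT0

/-- A `CAT(0)` space: a geodesic metric space satisfying the `CN` inequality of Bruhat and Tits.
Any two points `x`, `y` are joined by a geodesic, parametrized here on `[0, d(x,y)]`. -/
class CAT0Space (X : Type*) [MetricSpace X] : Prop where
  geodesic : ∀ x y : X, ∃ γ : ℝ → X, γ 0 = x ∧ γ (dist x y) = y ∧
    ∀ s ∈ Set.Icc (0 : ℝ) (dist x y), ∀ t ∈ Set.Icc (0 : ℝ) (dist x y),
      dist (γ s) (γ t) = |s - t|
  cn : ∀ x y z m : X, dist x m = dist x y / 2 → dist y m = dist x y / 2 →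
    dist z m ^ 2 ≤ dist z x ^ 2 / 2 + dist z y ^ 2 / 2 - dist x y ^ 2 / 4

/-- `m` is a point with `d(x,m) = t d(x,y)` and `d(y,m) = (1 - t) d(x,y)`. -/
def IsConvComb {X : Type*} [MetricSpace X] (x y : X) (t : ℝ) (m : X) : Prop :=
  dist x m = t * dist x y ∧ dist y m = (1 - t) * dist x y

/-- The point `(1 - t) x ⊕ t y`. In a `CAT(0)` space and for `t ∈ [0,1]` it is the unique `m` with
`d(x,m) = t d(x,y)` and `d(y,m) = (1 - t) d(x,y)`, see `isConvComb_convComb` and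
`IsConvComb.unique`. -/
noncomputable def convComb {X : Type*} [MetricSpace X] (x y : X) (t : ℝ) : X :=
  @Classical.epsilon X ⟨x⟩ (IsConvComb x y t)

theorem exists_isConvComb {X : Type*} [MetricSpace X] [CAT0Space X] (x y : X) {t : ℝ}
    (ht : t ∈ Set.Icc (0 : ℝ) 1) : ∃ m, IsConvComb x y t m := by
  obtain ⟨γ, h0, h1, h⟩ := CAT0Space.geodesic x y
  have hd : 0 ≤ dist x y := dist_nonneg
  have hm : t * dist x y ∈ Set.Icc (0 : ℝ) (dist x y) :=
    ⟨mul_nonneg ht.1 hd, mul_le_of_le_one_left hd ht.2⟩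
  refine ⟨γ (t * dist x y), ?_, ?_⟩
  · have := h 0 ⟨le_rfl, hd⟩ _ hm
    rwa [h0, zero_sub, abs_neg, abs_of_nonneg hm.1] at this
  · have := h (dist x y) ⟨hd, le_rfl⟩ _ hm
    rw [h1, abs_of_nonneg (sub_nonneg.2 hm.2)] at this
    rw [this]; ring

theorem isConvComb_convComb {X : Type*} [MetricSpace X] [CAT0Space X] (x y : X) {t : ℝ}
    (ht : t ∈ Set.Icc (0 : ℝ) 1) : IsConvComb x y t (convComb x y t) :=
  @Classical.epsilon_spec_aux X ⟨x⟩ _ (exists_isConvComb x y ht)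

theorem IsConvComb.unique {X : Type*} [MetricSpace X] [CAT0Space X] {x y m m' : X} {t : ℝ}
    (ht : t ∈ Set.Icc (0 : ℝ) 1) (h : IsConvComb x y t m) (h' : IsConvComb x y t m') :
    m = m' := by
  obtain ⟨p, hp1, hp2⟩ := exists_isConvComb m m' (t := 1 / 2) (by norm_num)
  have e1 : dist m p = dist m m' / 2 := by rw [hp1]; ring
  have e2 : dist m' p = dist m m' / 2 := by rw [hp2]; ring
  have c1 := CAT0Space.cn m m' x p e1 e2
  have c2 := CAT0Space.cn m m' y p e1 e2
  rw [h.1, h'.1] at c1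
  rw [h.2, h'.2] at c2
  have tri : dist x y ≤ dist x p + dist y p := dist_triangle_right x y p
  have hd : 0 ≤ dist x y := dist_nonneg
  have ha : 0 ≤ t * dist x y := mul_nonneg ht.1 hd
  have hb : 0 ≤ (1 - t) * dist x y := mul_nonneg (by linarith [ht.2]) hd
  by_contra hne
  have hpos : 0 < dist m m' := dist_pos.2 hne
  have l1 : dist x p < t * dist x y :=
    lt_of_pow_lt_pow_left₀ 2 ha (by nlinarith [pow_pos hpos 2])
  have l2 : dist y p < (1 - t) * dist x y :=
    lt_of_pow_lt_pow_left₀ 2 hb (by nlinarith [pow_pos hpos 2])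
  nlinarith

/-- `C` contains the segment `{(1 - t) x ⊕ t y : t ∈ [0,1]}` for all `x, y ∈ C`. -/
def IsConvexSubset {X : Type*} [MetricSpace X] (C : Set X) : Prop :=
  ∀ x ∈ C, ∀ y ∈ C, ∀ t ∈ Set.Icc (0 : ℝ) 1, convComb x y t ∈ C

/-- The Halpern iteration `x₀ = x`, `x_{n+1} = λ_{n+1} u ⊕ (1 - λ_{n+1}) T x_n`. -/
noncomputable def halpern {X : Type*} [MetricSpace X] (T : X → X) (lam : ℕ → ℝ) (u x : X) :
    ℕ → X
  | 0 => x
  | n + 1 => convComb u (T (halpern T lam u x n)) (1 - lam (n + 1))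

/-- `γ : (0,∞) → {1,2,…}` is a rate of convergence of `(a_n)_{n ≥ 1}` towards `a`. -/
def IsRateOfConvergence (γ : ℝ → ℕ) (s : ℕ → ℝ) (a : ℝ) : Prop :=
  ∀ ε > 0, 1 ≤ γ ε ∧ ∀ n ≥ γ ε, |s n - a| ≤ ε

/-- `γ : (0,∞) → {1,2,…}` is a Cauchy modulus of `(a_n)_{n ≥ 1}`. -/
def IsCauchyModulus (γ : ℝ → ℕ) (s : ℕ → ℝ) : Prop :=
  ∀ ε > 0, 1 ≤ γ ε ∧ ∀ n : ℕ, s (γ ε + n) - s (γ ε) ≤ ε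

/-- The partial product `∏_{i=1}^n (1 - λ_{i+1})`. -/
noncomputable def prodSeq (lam : ℕ → ℝ) (n : ℕ) : ℝ :=
  ∏ i ∈ Finset.Icc 1 n, (1 - lam (i + 1))

/-- The partial sum `∑_{i=1}^n |λ_{i+1} - λ_i|`. -/
noncomputable def varSeq (lam : ℕ → ℝ) (n : ℕ) : ℝ :=
  ∑ i ∈ Finset.Icc 1 n, |lam (i + 1) - lam i|

/-- The functional `Φ̃(δ) = θ(D(δ) δ / (2M)) + 1`. -/
noncomputable def PhiTilde (M : ℕ) (θ : ℝ → ℕ) (D : ℝ → ℝ) (δ : ℝ) : ℕ :=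
  θ (D δ * δ / (2 * M)) + 1

/-- The functional `Φ(δ) = max {θ(D(δ) δ / (4M)) + 1, α(δ / (4M))}`. -/
noncomputable def Phi (M : ℕ) (θ α : ℝ → ℕ) (D : ℝ → ℝ) (δ : ℝ) : ℕ :=
  max (θ (D δ * δ / (4 * M)) + 1) (α (δ / (4 * M)))

/-- The functional `P̃_k(δ)`. -/
noncomputable def PTilde (M : ℕ) (θ α : ℝ → ℕ) (D : ℝ → ℝ) (k : ℕ) (δ : ℝ) : ℕ :=
  ⌈12 * (M : ℝ) ^ 2 * (k + 1) / δ * (Phi M θ α D (δ / (12 * M * (k + 1))) : ℝ)⌉₊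

/-- The functional `χ*_k(δ)`. -/
noncomputable def chiStar (M : ℕ) (θ α : ℝ → ℕ) (D : ℝ → ℝ) (k : ℕ) (δ : ℝ) : ℕ :=
  PhiTilde M θ D (δ / (4 * M * ((PTilde M θ α D k (δ / 2) : ℝ) + 1))) +
    PTilde M θ α D k (δ / 2)

/-- The functional `Θ_k(δ) = θ(D_k(δ) δ / (3M²)) + 1`. -/
noncomputable def Theta (M : ℕ) (θ : ℝ → ℕ) (Dk : ℕ → ℝ → ℝ) (k : ℕ) (δ : ℝ) : ℕ :=
  θ (Dk k δ * δ / (3 * (M : ℝ) ^ 2)) + 1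

/-- `g_{δ,k}(n) = n + g(n + χ*_k(δ/3))`. -/
noncomputable def gShift (M : ℕ) (θ α : ℝ → ℕ) (D : ℝ → ℝ) (g : ℕ → ℕ) (δ : ℝ) (k n : ℕ) : ℕ :=
  n + g (n + chiStar M θ α D k (δ / 3))

/-- `Δ*_k(δ,g) = δ / (3 g_{δ,k}(Θ_k(δ) - χ*_k(δ/3)))`. For the arguments that occur in the bound
one has `Θ_k(δ) > χ*_k(δ/3)`, so that the subtraction is not truncated: `D_k(δ)` is at most the
product of the first `χ*_k(δ/3) - 1` factors, the product of the first `Θ_k(δ) - 1` factors is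
smaller than `D_k(δ)`, and the products decrease strictly. -/
noncomputable def DeltaStar (M : ℕ) (θ α : ℝ → ℕ) (D : ℝ → ℝ) (Dk : ℕ → ℝ → ℝ) (g : ℕ → ℕ)
    (k : ℕ) (δ : ℝ) : ℝ :=
  δ / (3 * (gShift M θ α D g δ k (Theta M θ Dk k δ - chiStar M θ α D k (δ / 3)) : ℝ))

/-- `ε₀ = ε² / (24 (M+1)²)`. -/
noncomputable def eps0 (M : ℕ) (ε : ℝ) : ℝ := ε ^ 2 / (24 * ((M : ℝ) + 1) ^ 2)

/-- `f(k) = max {⌈M² / Δ*_k(ε²/4,g)⌉, k} - k`. -/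
noncomputable def fFun (M : ℕ) (θ α : ℝ → ℕ) (D : ℝ → ℝ) (Dk : ℕ → ℝ → ℝ) (g : ℕ → ℕ)
    (ε : ℝ) (k : ℕ) : ℕ :=
  max ⌈(M : ℝ) ^ 2 / DeltaStar M θ α D Dk g k (ε ^ 2 / 4)⌉₊ k - k

/-- `f*(k) = f(k + ⌈1/ε₀⌉) + ⌈1/ε₀⌉`. -/
noncomputable def fStar (M : ℕ) (θ α : ℝ → ℕ) (D : ℝ → ℝ) (Dk : ℕ → ℝ → ℝ) (g : ℕ → ℕ)
    (ε : ℝ) (k : ℕ) : ℕ :=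
  fFun M θ α D Dk g ε (k + ⌈1 / eps0 M ε⌉₊) + ⌈1 / eps0 M ε⌉₊

/-- `f̃*(k) = k + f*(k)`. -/
noncomputable def fStarTilde (M : ℕ) (θ α : ℝ → ℕ) (D : ℝ → ℝ) (Dk : ℕ → ℝ → ℝ) (g : ℕ → ℕ)
    (ε : ℝ) (k : ℕ) : ℕ :=
  k + fStar M θ α D Dk g ε k

/-- The rate of metastability: the maximum of `Θ_k(ε²/4)` over all `k` with
`⌈1/ε₀⌉ ≤ k ≤ (f̃*)^(⌈M²/ε₀²⌉)(0) + ⌈1/ε₀⌉`, a nonempty range. -/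
noncomputable def Sigma (M : ℕ) (θ α : ℝ → ℕ) (D : ℝ → ℝ) (Dk : ℕ → ℝ → ℝ) (ε : ℝ)
    (g : ℕ → ℕ) : ℕ :=
  (Finset.Icc ⌈1 / eps0 M ε⌉₊
    ((fStarTilde M θ α D Dk g ε)^[⌈(M : ℝ) ^ 2 / eps0 M ε ^ 2⌉₊] 0 + ⌈1 / eps0 M ε⌉₊)).sup
    fun k => Theta M θ Dk k (ε ^ 2 / 4)

end HalpernCAT0

/-! Let `z k` be the fixed point of y ↦ t u ⊕ (1 - t) T y for t = 1/(k+1). By the CN inequality d(u,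
z k)² is nondecreasing in k. Being bounded by M², it grows by at most ε₀² between suitable indices k
≤ j, where j may be as large as a prescribed function of k demands. No limit of the resolvents is
needed.

The two indices have separate tasks. Asymptotic regularity (`dist_halpern_map_le`) applied with `z
k` shows that d(u, z k)² barely exceeds d(u, x_n)² from a threshold χ on, and the small gap
transfers this to `z j`. Then d(x_n, z j)² obeys the recursion of `dist_sq_halpern_succ_le`: a
factor 1 - λ, a small multiple of λ, and a drift M²/(j+1) per step. By `prodSeq_mul_le` the
vanishing products remove the initial distance from N = Θ_k on. Since χ and N do not depend on j,
the choice of j keeps the drift up to N + g N small, so the whole window lies within ε/2 of `z j`.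
-/

namespace HalpernCAT0

/-! ### Convexity of the squared distance, and resolvents -/

section Geometry

variable {X : Type*} [MetricSpace X] [CAT0Space X]

/-- The `CN` inequality for an arbitrary point of a segment. -/
theorem IsConvComb.dist_sq_le {x y m : X} {t : ℝ} (ht : t ∈ Set.Icc (0 : ℝ) 1)
    (h : IsConvComb x y t m) (z : X) :
    dist z m ^ 2 ≤ (1 - t) * dist z x ^ 2 + t * dist z y ^ 2 - t * (1 - t) * dist x y ^ 2 := by
  obtain ⟨γ, h0, h1, hγ⟩ := CAT0Space.geodesic x y
  have hd : 0 ≤ dist x y := dist_nonneg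
  have hmem : ∀ s ∈ Set.Icc (0 : ℝ) 1, s * dist x y ∈ Set.Icc (0 : ℝ) (dist x y) := fun s hs =>
    ⟨mul_nonneg hs.1 hd, mul_le_of_le_one_left hd hs.2⟩
  have hdist : ∀ s ∈ Set.Icc (0 : ℝ) 1, ∀ r ∈ Set.Icc (0 : ℝ) 1,
      dist (γ (s * dist x y)) (γ (r * dist x y)) = |s - r| * dist x y := by
    intro s hs r hr
    rw [hγ _ (hmem s hs) _ (hmem r hr), ← sub_mul, abs_mul, abs_of_nonneg hd]
  have hx : ∀ s ∈ Set.Icc (0 : ℝ) 1, dist x (γ (s * dist x y)) = s * dist x y := by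
    intro s hs
    have := hdist 0 (by norm_num) s hs
    rwa [zero_mul, h0, zero_sub, abs_neg, abs_of_nonneg hs.1] at this
  have hy : ∀ s ∈ Set.Icc (0 : ℝ) 1, dist y (γ (s * dist x y)) = (1 - s) * dist x y := by
    intro s hs
    have := hdist 1 (by norm_num) s hs
    rwa [one_mul, h1, abs_of_nonneg (by linarith [hs.2])] at this
  have hm : m = γ (t * dist x y) := h.unique ht ⟨hx t ht, hy t ht⟩
  -- the defect is halved at each bisection step
  have key : ∀ n : ℕ, ∀ s ∈ Set.Icc (0 : ℝ) 1,
      dist z (γ (s * dist x y)) ^ 2 - (1 - s) * dist z x ^ 2 - s * dist z y ^ 2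
        + s * (1 - s) * dist x y ^ 2
        ≤ ((dist z x + dist x y) ^ 2 + dist x y ^ 2) * (1 / 2) ^ n := by
    intro n
    induction n with
    | zero =>
      intro s hs
      have h1' : dist z (γ (s * dist x y)) ≤ dist z x + dist x y := by
        have := dist_triangle z x (γ (s * dist x y))
        rw [hx s hs] at this
        have := (hmem s hs).2
        linarith
      have h2 : dist z (γ (s * dist x y)) ^ 2 ≤ (dist z x + dist x y) ^ 2 :=
        pow_le_pow_left₀ dist_nonneg h1' 2
      have h3 : 0 ≤ (1 - s) * dist z x ^ 2 := mul_nonneg (by linarith [hs.2]) (sq_nonneg _)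
      have h4 : 0 ≤ s * dist z y ^ 2 := mul_nonneg hs.1 (sq_nonneg _)
      have h5 : s * (1 - s) * dist x y ^ 2 ≤ 1 * dist x y ^ 2 :=
        mul_le_mul_of_nonneg_right (by nlinarith [hs.1, hs.2]) (sq_nonneg _)
      simp only [pow_zero, mul_one]
      linarith
    | succ n ih =>
      intro s hs
      rw [pow_succ (1 / 2 : ℝ), ← mul_assoc]
      -- The point at s is the midpoint of x and the point at 2s, or of y and the point at 2s - 1.
      rcases le_total s (1 / 2) with hs2 | hs2
      · have hr : 2 * s ∈ Set.Icc (0 : ℝ) 1 := ⟨by linarith [hs.1], by linarith⟩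
        have c := CAT0Space.cn x (γ (2 * s * dist x y)) z (γ (s * dist x y))
          (by rw [hx s hs, hx _ hr]; ring)
          (by rw [hdist _ hr _ hs, hx _ hr, abs_of_nonneg (by linarith [hs.1])]; ring)
        rw [hx _ hr] at c
        linarith [ih _ hr]
      · have hr : 2 * s - 1 ∈ Set.Icc (0 : ℝ) 1 := ⟨by linarith, by linarith [hs.2]⟩
        have c := CAT0Space.cn y (γ ((2 * s - 1) * dist x y)) z (γ (s * dist x y))
          (by rw [hy s hs, hy _ hr]; ring)
          (by rw [hdist _ hr _ hs, hy _ hr, abs_of_nonpos (by linarith [hs.2])]; ring)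
        rw [hy _ hr] at c
        linarith [ih _ hr]
  have hlim : Filter.Tendsto
      (fun n : ℕ => ((dist z x + dist x y) ^ 2 + dist x y ^ 2) * (1 / 2 : ℝ) ^ n)
      Filter.atTop (nhds 0) := by
    have := (tendsto_pow_atTop_nhds_zero_of_lt_one (r := (1 / 2 : ℝ)) (by norm_num)
      (by norm_num)).const_mul ((dist z x + dist x y) ^ 2 + dist x y ^ 2)
    rwa [mul_zero] at this
  have := ge_of_tendsto' hlim fun n => key n t ht
  rw [← hm] at this
  linarith

/-- Use `dist_sq_le` for p seen from b, then for q seen from p: all terms in d(u,a) and d(u,b)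
cancel and s² d(a,b)² remains. -/
theorem IsConvComb.dist_le_mul {u a b p q : X} {s : ℝ} (hs : s ∈ Set.Icc (0 : ℝ) 1)
    (hp : IsConvComb u a s p) (hq : IsConvComb u b s q) : dist p q ≤ s * dist a b := by
  have h1 := hp.dist_sq_le hs b
  have h2 := hq.dist_sq_le hs p
  rw [dist_comm p u, hp.1, dist_comm p b] at h2
  rw [dist_comm b u, dist_comm b a] at h1
  have h3 := mul_le_mul_of_nonneg_left h1 hs.1
  exact le_of_sq_le_sq (by linarith) (mul_nonneg hs.1 dist_nonneg)

theorem IsConvComb.dist_le_abs_mul {u b p q : X} {s r : ℝ} (hs : s ∈ Set.Icc (0 : ℝ) 1)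
    (hp : IsConvComb u b s p) (hq : IsConvComb u b r q) :
    dist p q ≤ |s - r| * dist u b := by
  have h1 := hp.dist_sq_le hs q
  rw [dist_comm q u, hq.1, dist_comm q b, hq.2, dist_comm q p] at h1
  refine le_of_sq_le_sq ?_ (mul_nonneg (abs_nonneg _) dist_nonneg)
  rw [mul_pow, sq_abs]
  linarith

/-- `z` is the fixed point of `y ↦ t u ⊕ (1 - t) T y`. -/
theorem exists_resolvent [CompleteSpace X] {C : Set X} (hC : IsClosed C)
    (hconv : IsConvexSubset C) {T : X → X} (hTC : Set.MapsTo T C C)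
    (hT : ∀ y ∈ C, ∀ z ∈ C, dist (T y) (T z) ≤ dist y z) {u : X} (hu : u ∈ C) {t : ℝ}
    (ht0 : 0 < t) (ht1 : t ≤ 1) : ∃ z ∈ C, IsConvComb u (T z) (1 - t) z := by
  have ht : 1 - t ∈ Set.Icc (0 : ℝ) 1 := ⟨by linarith, by linarith⟩
  have hmaps : Set.MapsTo (fun y => convComb u (T y) (1 - t)) C C := fun y hy =>
    hconv u hu _ (hTC hy) _ ht
  have hcontr : ContractingWith (1 - t).toNNReal (hmaps.restrict _ C C) := by
    refine ⟨by rw [← Real.toNNReal_one, Real.toNNReal_lt_toNNReal_iff one_pos]; linarith, ?_⟩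
    refine LipschitzWith.of_dist_le_mul fun y z => ?_
    rw [Real.coe_toNNReal _ ht.1]
    exact ((isConvComb_convComb u (T y) ht).dist_le_mul ht (isConvComb_convComb u (T z) ht)).trans
      (mul_le_mul_of_nonneg_left (hT y y.2 z z.2) ht.1)
  obtain ⟨z, hz, hfix, -⟩ := hcontr.exists_fixedPoint' hC.isComplete hmaps hu (edist_ne_top _ _)
  refine ⟨z, hz, ?_⟩
  have h := isConvComb_convComb u (T z) ht
  rwa [show convComb u (T z) (1 - t) = z from hfix] at h

/-- Combining the inequalities for z seen from w and for w seen from Tz bounds a nonnegative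
multiple of d(z,w)² by (t - s) times a bracket (`h6`). For s < t the bracket is therefore
nonnegative, which gives the claim; for s = t it follows that z = w. -/
theorem dist_sq_resolvent_mono {u z w Tz Tw : X} {t s : ℝ} (hs0 : 0 < s) (hst : s ≤ t)
    (ht1 : t ≤ 1) (hz : IsConvComb u Tz (1 - t) z) (hw : IsConvComb u Tw (1 - s) w)
    (hT : dist Tz Tw ≤ dist z w) : dist u z ^ 2 ≤ dist u w ^ 2 := by
  have ht : 1 - t ∈ Set.Icc (0 : ℝ) 1 := ⟨by linarith, by linarith⟩
  have hs : 1 - s ∈ Set.Icc (0 : ℝ) 1 := ⟨by linarith, by linarith⟩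
  have h1 := hz.dist_sq_le ht w
  have h2 := hw.dist_sq_le hs Tz
  rw [dist_comm w u, hw.1, dist_comm w Tz, dist_comm w z] at h1
  rw [dist_comm Tz u] at h2
  have h3 : dist Tz Tw ^ 2 ≤ dist z w ^ 2 := pow_le_pow_left₀ dist_nonneg hT 2
  rw [hz.1, hw.1]
  have h4 := mul_le_mul_of_nonneg_left h2 ht.1
  have h5 := mul_le_mul_of_nonneg_left h3 (mul_nonneg ht.1 hs.1)
  have h6 : (1 - (1 - t) * (1 - s)) * dist z w ^ 2 ≤
      (t - s) * ((1 - s) * dist u Tw ^ 2 - (1 - t) * dist u Tz ^ 2) := by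
    linarith
  have hpos : 0 < 1 - (1 - t) * (1 - s) := by nlinarith [ht.1, ht.2, hs.1, hs.2]
  rcases hst.eq_or_lt with rfl | hlt
  · have hE : dist z w ^ 2 ≤ 0 := by
      by_contra hne
      have := mul_pos hpos (not_le.1 hne)
      linarith
    have : z = w := dist_le_zero.1 (by nlinarith [dist_nonneg (x := z) (y := w)])
    rw [← hz.1, ← hw.1, this]
  · have h7 : 0 ≤ (1 - s) * dist u Tw ^ 2 - (1 - t) * dist u Tz ^ 2 := by
      by_contra hne
      have h8 := mul_pos (sub_pos.2 hlt) (neg_pos.2 (not_le.1 hne))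
      have h9 := mul_nonneg hpos.le (sq_nonneg (dist z w))
      linarith
    have h8 := mul_nonneg hs.1 h7
    have h9 : 0 ≤ (1 - t) * (t - s) * dist u Tz ^ 2 :=
      mul_nonneg (mul_nonneg ht.1 (by linarith)) (sq_nonneg _)
    linarith

/-- Asymptotically, approximate fixed points are at least as far from `u` as the resolvents. -/
theorem mul_dist_sq_resolvent_le {u z y Tz Ty : X} {t M : ℝ} (ht0 : 0 < t) (ht1 : t ≤ 1)
    (hz : IsConvComb u Tz (1 - t) z) (hT : dist Tz Ty ≤ dist z y) (hzy : dist z y ≤ M)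
    (hy : dist y Ty ≤ M) :
    t * dist u z ^ 2 ≤ t * dist u y ^ 2 + 3 * M * dist y Ty := by
  have ht : 1 - t ∈ Set.Icc (0 : ℝ) 1 := ⟨by linarith, by linarith⟩
  have h1 := hz.dist_sq_le ht y
  have h2 : dist y Tz ≤ dist y Ty + dist z y := by
    have := dist_triangle y Ty Tz
    rw [dist_comm Ty Tz] at this
    linarith
  have h3 : dist y Tz ^ 2 ≤ (dist y Ty + dist z y) ^ 2 := pow_le_pow_left₀ dist_nonneg h2 2
  have hd : 0 ≤ dist y Ty := dist_nonneg
  -- Of the constant 3M, the cross term contributes 2M and d(y,Ty)² contributes M.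
  have h4 : dist y Tz ^ 2 ≤ dist z y ^ 2 + 3 * M * dist y Ty := by
    have h5 := mul_le_mul_of_nonneg_right hy hd
    have h6 := mul_le_mul_of_nonneg_right hzy hd
    linarith
  rw [dist_comm y u, dist_comm y z] at h1
  have h5 := mul_le_mul_of_nonneg_left h4 ht.1
  have h6 : t * (3 * M * dist y Ty) ≥ 0 := mul_nonneg ht0.le
    (mul_nonneg (by linarith) hd)
  have h7 : 0 ≤ t * dist z y ^ 2 := mul_nonneg ht0.le (sq_nonneg _)
  have h8 : 0 ≤ t * ((1 - t) * t * dist u Tz ^ 2) :=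
    mul_nonneg ht0.le (mul_nonneg (mul_nonneg ht.1 ht0.le) (sq_nonneg _))
  rw [hz.1]
  linarith

/-- For small t the resolvent is nearly fixed by T, so applying T to y hardly increases the distance
to z. The loss t M² is the drift that later accumulates over the window. -/
theorem dist_sq_resolvent_le {u z Ty Tz y : X} {t M : ℝ} (ht0 : 0 < t) (ht1 : t ≤ 1)
    (hz : IsConvComb u Tz (1 - t) z) (hT : dist Ty Tz ≤ dist y z) (huy : dist u Ty ≤ M) :
    dist Ty z ^ 2 ≤ dist y z ^ 2 + t * M ^ 2 := by
  have ht : 1 - t ∈ Set.Icc (0 : ℝ) 1 := ⟨by linarith, by linarith⟩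
  have h1 := hz.dist_sq_le ht Ty
  have h2 : dist Ty Tz ^ 2 ≤ dist y z ^ 2 := pow_le_pow_left₀ dist_nonneg hT 2
  have h3 : dist u Ty ^ 2 ≤ M ^ 2 := pow_le_pow_left₀ dist_nonneg huy 2
  rw [dist_comm Ty u] at h1
  have h4 := mul_le_mul_of_nonneg_left h2 ht.1
  have h5 := mul_le_mul_of_nonneg_left h3 ht0.le
  have h6 : 0 ≤ t * dist y z ^ 2 := mul_nonneg ht0.le (sq_nonneg _)
  have h7 : 0 ≤ (1 - t) * (1 - (1 - t)) * dist u Tz ^ 2 :=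
    mul_nonneg (mul_nonneg ht.1 (by linarith)) (sq_nonneg _)
  linarith

end Geometry

/-! ### Real sequences: bounded growth, products and sums -/

section RealSequences

/-- Otherwise the n increments would sum to more than nδ ≥ B. This is the finitary form of the
convergence of bounded monotone sequences. -/
theorem exists_iterate_sub_le {a : ℕ → ℝ} {B δ : ℝ} (ha0 : ∀ k, 0 ≤ a k) (haB : ∀ k, a k ≤ B)
    (h : ℕ → ℕ) {n : ℕ} (hn : 1 ≤ n) (hB : B ≤ n * δ) :
    ∃ i < n, a (h^[i + 1] 0) - a (h^[i] 0) ≤ δ := by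
  by_contra! hcon
  have key : ∀ i ≤ n, 1 ≤ i → i * δ < a (h^[i] 0) := by
    intro i
    induction i with
    | zero => intro _ h0; omega
    | succ i ih =>
      intro hi _
      have h1 := hcon i (by omega)
      push_cast
      rcases Nat.eq_zero_or_pos i with rfl | hpos
      · have := ha0 (h^[0] 0)
        push_cast
        linarith
      · have := ih (by omega) hpos
        linarith
  linarith [key n le_rfl hn, haB (h^[n] 0)]

theorem prodSeq_succ (lam : ℕ → ℝ) (n : ℕ) :
    prodSeq lam (n + 1) = prodSeq lam n * (1 - lam (n + 2)) := by
  unfold prodSeq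
  rw [Finset.prod_Icc_succ_top (by omega)]

theorem varSeq_succ (lam : ℕ → ℝ) (n : ℕ) :
    varSeq lam (n + 1) = varSeq lam n + |lam (n + 2) - lam (n + 1)| := by
  unfold varSeq
  rw [Finset.sum_Icc_succ_top (by omega)]

theorem varSeq_monotone (lam : ℕ → ℝ) : Monotone (varSeq lam) :=
  monotone_nat_of_le_succ fun n => by rw [varSeq_succ]; linarith [abs_nonneg (lam (n + 2) - lam (n + 1))]


theorem prodSeq_pos {lam : ℕ → ℝ} (hlam : ∀ n, 2 ≤ n → lam n ∈ Set.Ioo (0 : ℝ) 1) (n : ℕ) : 0 < prodSeq lam n :=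
  Finset.prod_pos fun i hi => by
    linarith [(hlam (i + 1) (by have := (Finset.mem_Icc.1 hi).1; omega)).2]

end RealSequences

/-! ### The Halpern iteration: recursions, asymptotic regularity, metastability -/

section Iteration

/-- Unrolled recursion: the initial value is damped by the product, the errors are merely summed. No
sign of `s` is required, so a constant may be subtracted from a squared distance. -/
theorem prodSeq_mul_le {lam : ℕ → ℝ} (hlam : ∀ n, 2 ≤ n → lam n ∈ Set.Ioo (0 : ℝ) 1)
    {s W : ℕ → ℝ} (hW : Monotone W) {m : ℕ}
    (hs : ∀ n ≥ m, s (n + 1) ≤ (1 - lam (n + 2)) * s n + (W (n + 1) - W n)) (i : ℕ) :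
    prodSeq lam m * s (m + i) ≤ prodSeq lam (m + i) * s m + prodSeq lam m * (W (m + i) - W m) := by
  induction i with
  | zero => simp
  | succ i ih =>
    have hP := prodSeq_pos hlam m
    have hl := hlam (m + i + 2) (by omega)
    have h1 := mul_le_mul_of_nonneg_left (hs (m + i) (by omega)) hP.le
    have h2 := mul_le_mul_of_nonneg_left ih (by linarith [hl.2] : (0 : ℝ) ≤ 1 - lam (m + i + 2))
    have h3 : 0 ≤ lam (m + i + 2) * (prodSeq lam m * (W (m + i) - W m)) :=
      mul_nonneg hl.1.le (mul_nonneg hP.le (sub_nonneg.2 (hW (by omega))))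
    rw [← add_assoc, prodSeq_succ]
    linarith

theorem prodSeq_strictAnti {lam : ℕ → ℝ} (hlam : ∀ n, 2 ≤ n → lam n ∈ Set.Ioo (0 : ℝ) 1) :
    StrictAnti (prodSeq lam) :=
  strictAnti_nat_of_succ_lt fun n => by
    rw [prodSeq_succ]
    have := mul_pos (prodSeq_pos hlam n) (hlam (n + 2) (by omega)).1
    linarith

variable {X : Type*} [MetricSpace X] {C : Set X} {T : X → X} {u x : X}
  {lam : ℕ → ℝ}

theorem halpern_mem (hconv : IsConvexSubset C) (hTC : Set.MapsTo T C C) (hu : u ∈ C) (hx : x ∈ C)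
    (hlam : ∀ n, 1 ≤ n → lam n ∈ Set.Icc (0 : ℝ) 1) (n : ℕ) : halpern T lam u x n ∈ C := by
  induction n with
  | zero => exact hx
  | succ n ih =>
    have h := hlam (n + 1) (by omega)
    exact hconv u hu _ (hTC ih) _ ⟨by linarith [h.2], by linarith [h.1]⟩

variable [CAT0Space X]

theorem isConvComb_halpern (hlam : ∀ n, 1 ≤ n → lam n ∈ Set.Icc (0 : ℝ) 1) (n : ℕ) :
    IsConvComb u (T (halpern T lam u x n)) (1 - lam (n + 1)) (halpern T lam u x (n + 1)) := by
  have h := hlam (n + 1) (by omega)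
  exact isConvComb_convComb _ _ ⟨by linarith [h.2], by linarith [h.1]⟩

/-- The intermediate point on the segment from u to T x_n with weight λ_{n+2} shares its weight with
x_{n+2} and its segment with x_{n+1}. -/
theorem dist_halpern_succ_le (hlam : ∀ n, 1 ≤ n → lam n ∈ Set.Icc (0 : ℝ) 1) {M : ℝ} (n : ℕ)
    (hT : dist (T (halpern T lam u x (n + 1))) (T (halpern T lam u x n)) ≤
      dist (halpern T lam u x (n + 1)) (halpern T lam u x n))
    (hM : dist u (T (halpern T lam u x n)) ≤ M) :
    dist (halpern T lam u x (n + 2)) (halpern T lam u x (n + 1)) ≤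
      (1 - lam (n + 2)) * dist (halpern T lam u x (n + 1)) (halpern T lam u x n) +
        M * |lam (n + 2) - lam (n + 1)| := by
  have h := hlam (n + 2) (by omega)
  have h1 : 1 - lam (n + 2) ∈ Set.Icc (0 : ℝ) 1 := ⟨by linarith [h.2], by linarith [h.1]⟩
  have hq := isConvComb_convComb u (T (halpern T lam u x n)) h1
  have e1 := (isConvComb_halpern (T := T) (u := u) (x := x) hlam (n + 1)).dist_le_mul h1 hq
  have e2 := hq.dist_le_abs_mul h1 (isConvComb_halpern hlam n)
  have e3 := mul_le_mul_of_nonneg_left hT h1.1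
  have e4 : |1 - lam (n + 2) - (1 - lam (n + 1))| = |lam (n + 2) - lam (n + 1)| := by
    rw [← abs_neg]; congr 1; ring
  rw [e4] at e2
  have e5 := mul_le_mul_of_nonneg_left hM (abs_nonneg (lam (n + 2) - lam (n + 1)))
  have := dist_triangle (halpern T lam u x (n + 2)) (convComb u (T (halpern T lam u x n))
    (1 - lam (n + 2))) (halpern T lam u x (n + 1))
  linarith

/-- `Phi` is a rate of asymptotic regularity. -/
theorem dist_halpern_map_le (hconv : IsConvexSubset C) (hTC : Set.MapsTo T C C)
    (hT : ∀ y ∈ C, ∀ z ∈ C, dist (T y) (T z) ≤ dist y z) (hu : u ∈ C) (hx : x ∈ C)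
    (hlam : ∀ n, 1 ≤ n → lam n ∈ Set.Icc (0 : ℝ) 1)
    (hlam' : ∀ n, 2 ≤ n → lam n ∈ Set.Ioo (0 : ℝ) 1) {M : ℕ} (hM : 1 ≤ M)
    (hdist : ∀ y ∈ C, ∀ z ∈ C, dist y z ≤ M) {α β θ : ℝ → ℕ} {D : ℝ → ℝ}
    (hα : IsRateOfConvergence α lam 0) (hβ : IsCauchyModulus β (varSeq lam))
    (hθ : IsRateOfConvergence θ (prodSeq lam) 0)
    (hD : ∀ δ > 0, 0 < D δ ∧ D δ ≤ prodSeq lam (β (δ / (4 * M)))) {δ : ℝ} (hδ : 0 < δ) {n : ℕ}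
    (hn : Phi M θ α D δ ≤ n) :
    dist (halpern T lam u x n) (T (halpern T lam u x n)) ≤ δ := by
  have hM' : (1 : ℝ) ≤ M := by exact_mod_cast hM
  have hMpos : (0 : ℝ) < M := by linarith
  have hmem := halpern_mem hconv hTC hu hx hlam
  obtain ⟨hD0, hD1⟩ := hD δ hδ
  set m := β (δ / (4 * M)) with hm
  have hδ4 : 0 < δ / (4 * M) := by positivity
  have hnθ : θ (D δ * δ / (4 * M)) ≤ n := by
    have := (le_max_left _ _).trans hn
    omega
  have hnα : α (δ / (4 * M)) ≤ n := (le_max_right _ _).trans hn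
  have hPn : prodSeq lam n ≤ prodSeq lam m * (δ / (4 * M)) := by
    have h1 := (hθ (D δ * δ / (4 * M)) (by positivity)).2 n hnθ
    rw [sub_zero] at h1
    have h2 := mul_le_mul_of_nonneg_right hD1 hδ4.le
    have h3 := le_abs_self (prodSeq lam n)
    have h4 : D δ * δ / (4 * M) = D δ * (δ / (4 * M)) := by ring
    linarith
  have hMδ : M * (δ / (4 * M)) = δ / 4 := by field_simp
  have hreg : dist (halpern T lam u x (n + 1)) (halpern T lam u x n) ≤ δ / 2 := by
    have hPm := prodSeq_pos hlam' m
    rcases le_total m n with hmn | hmn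
    · obtain ⟨i, rfl⟩ := Nat.exists_eq_add_of_le hmn
      have h1 := prodSeq_mul_le (m := m) hlam'
        (s := fun n => dist (halpern T lam u x (n + 1)) (halpern T lam u x n))
        (W := fun n => M * varSeq lam n)
        (fun a b hab => mul_le_mul_of_nonneg_left (varSeq_monotone lam hab) hMpos.le)
        (fun n _ => by
          have := dist_halpern_succ_le hlam n (hT _ (hmem (n + 1)) _ (hmem n))
            (hdist _ hu _ (hTC (hmem n)))
          rw [varSeq_succ]
          linarith) i
      have h2 := (hβ _ hδ4).2 i
      rw [← hm] at h2
      have h3 := mul_le_mul_of_nonneg_left h2 (mul_nonneg hPm.le hMpos.le)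
      have h4 := mul_le_mul_of_nonneg_left (hdist _ (hmem (m + 1)) _ (hmem m))
        (prodSeq_pos hlam' (m + i)).le
      have h5 := mul_le_mul_of_nonneg_right hPn hMpos.le
      refine le_of_mul_le_mul_left ?_ hPm
      have h6 : prodSeq lam m * M * (δ / (4 * M)) = prodSeq lam m * (δ / 4) := by
        rw [mul_assoc, hMδ]
      linarith
    -- If n ≤ m, then P_m ≤ P_n ≤ P_m δ/(4M) forces δ ≥ 4M, and the diameter bound suffices.
    · have h1 := (prodSeq_strictAnti hlam').antitone hmn
      have h2 : 1 ≤ δ / (4 * M) := le_of_mul_le_mul_left (by linarith) hPm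
      have h3 := mul_le_mul_of_nonneg_left h2 hMpos.le
      linarith [hdist _ (hmem (n + 1)) _ (hmem n)]
  have hlast : dist (halpern T lam u x (n + 1)) (T (halpern T lam u x n)) ≤ δ / 4 := by
    have h1 := (isConvComb_halpern (T := T) (u := u) (x := x) hlam n).2
    have h2 := (hα _ hδ4).2 (n + 1) (by omega)
    rw [sub_zero, abs_of_nonneg (hlam (n + 1) (by omega)).1] at h2
    have h3 := hdist _ hu _ (hTC (hmem n))
    have h4 := mul_le_mul h2 h3 dist_nonneg hδ4.le
    rw [dist_comm, h1]
    linarith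
  have := dist_triangle_left (halpern T lam u x n) (T (halpern T lam u x n))
    (halpern T lam u x (n + 1))
  linarith

/-- The summand P̃_k(δ/2) is enough: it is `Phi` at this argument times a factor that is at least 1
because δ ≤ 1. -/
theorem Phi_le_chiStar (M : ℕ) (hM : 1 ≤ M) (θ α : ℝ → ℕ) (D : ℝ → ℝ) (k : ℕ) {δ : ℝ}
    (hδ : 0 < δ) (hδ1 : δ ≤ 1) :
    Phi M θ α D (δ / (24 * M * (k + 1))) ≤ chiStar M θ α D k δ := by
  have hM' : (1 : ℝ) ≤ M := by exact_mod_cast hM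
  have hk : (0 : ℝ) ≤ k := Nat.cast_nonneg k
  have h1 : δ / 2 / (12 * M * (k + 1)) = δ / (24 * M * (k + 1)) := by
    rw [div_div]; congr 1; ring
  have h2 : (Phi M θ α D (δ / (24 * M * (k + 1))) : ℝ) ≤ PTilde M θ α D k (δ / 2) := by
    unfold PTilde
    refine le_trans ?_ (Nat.le_ceil _)
    rw [h1]
    refine le_mul_of_one_le_left (Nat.cast_nonneg _) ?_
    rw [one_le_div (by positivity)]
    nlinarith [mul_nonneg (sq_nonneg (M : ℝ)) hk, mul_le_mul hM' hM' zero_le_one (by linarith)]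
  have h3 : Phi M θ α D (δ / (24 * M * (k + 1))) ≤ PTilde M θ α D k (δ / 2) := by
    exact_mod_cast h2
  unfold chiStar
  omega

theorem chiStar_pos (M : ℕ) (θ α : ℝ → ℕ) (D : ℝ → ℝ) (k : ℕ) (δ : ℝ) :
    1 ≤ chiStar M θ α D k δ := by
  unfold chiStar PhiTilde
  omega

theorem chiStar_lt_Theta (hlam' : ∀ n, 2 ≤ n → lam n ∈ Set.Ioo (0 : ℝ) 1) {M : ℕ} (hM : 1 ≤ M)
    {α θ : ℝ → ℕ} {D : ℝ → ℝ} {Dk : ℕ → ℝ → ℝ} (hθ : IsRateOfConvergence θ (prodSeq lam) 0)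
    {k : ℕ} {δ : ℝ} (hδ : 0 < δ) (hδ1 : δ < 1) (hDk0 : 0 < Dk k δ)
    (hDk : Dk k δ ≤ prodSeq lam (chiStar M θ α D k (δ / 3) - 1)) :
    chiStar M θ α D k (δ / 3) < Theta M θ Dk k δ := by
  have hM' : (1 : ℝ) ≤ M := by exact_mod_cast hM
  have h1 := (hθ (Dk k δ * δ / (3 * (M : ℝ) ^ 2)) (by positivity)).2 _ le_rfl
  rw [sub_zero] at h1
  have h2 : Dk k δ * δ / (3 * (M : ℝ) ^ 2) < Dk k δ := by
    rw [div_lt_iff₀ (by positivity)]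
    exact mul_lt_mul_of_pos_left (by nlinarith) hDk0
  have h3 := (prodSeq_strictAnti hlam').lt_iff_gt.1
    (((le_abs_self _).trans h1).trans_lt (h2.trans_le hDk))
  unfold Theta
  omega

/-- The negative CN term λ(1-λ) d(u,Tx_n)² absorbs λ d(u,x_{n+1})² = λ(1-λ)² d(u,Tx_n)², so only the
excess b survives, with weight λ. -/
theorem dist_sq_halpern_succ_le (hlam : ∀ n, 1 ≤ n → lam n ∈ Set.Icc (0 : ℝ) 1) {M t b : ℝ} {z : X}
    (ht0 : 0 < t) (ht1 : t ≤ 1) (hz : IsConvComb u (T z) (1 - t) z) (n : ℕ)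
    (hT : dist (T (halpern T lam u x n)) (T z) ≤ dist (halpern T lam u x n) z)
    (hM : dist u (T (halpern T lam u x n)) ≤ M)
    (hb : dist u z ^ 2 ≤ dist u (halpern T lam u x (n + 1)) ^ 2 + b) :
    dist (halpern T lam u x (n + 1)) z ^ 2 ≤
      (1 - lam (n + 1)) * dist (halpern T lam u x n) z ^ 2 + lam (n + 1) * b + t * M ^ 2 := by
  have h := hlam (n + 1) (by omega)
  have h1 : 1 - lam (n + 1) ∈ Set.Icc (0 : ℝ) 1 := ⟨by linarith [h.2], by linarith [h.1]⟩
  have hx := isConvComb_halpern (T := T) (u := u) (x := x) hlam n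
  have e1 := hx.dist_sq_le h1 z
  have e2 := dist_sq_resolvent_le ht0 ht1 hz hT hM
  rw [dist_comm z, dist_comm z, dist_comm z] at e1
  rw [hx.1] at hb
  have e3 := mul_le_mul_of_nonneg_left e2 h1.1
  have e4 := mul_le_mul_of_nonneg_left hb h.1
  have e5 : 0 ≤ lam (n + 1) * (t * M ^ 2) := mul_nonneg h.1 (mul_nonneg ht0.le (sq_nonneg _))
  have e6 : 0 ≤ lam (n + 1) * (lam (n + 1) * (1 - lam (n + 1)) *
      dist u (T (halpern T lam u x n)) ^ 2) :=
    mul_nonneg h.1 (mul_nonneg (mul_nonneg h.1 h1.1) (sq_nonneg _))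
  linarith

theorem halpern_metastable [CompleteSpace X] (hC : IsClosed C) (hconv : IsConvexSubset C)
    (hTC : Set.MapsTo T C C)
    (hT : ∀ y ∈ C, ∀ z ∈ C, dist (T y) (T z) ≤ dist y z) (hu : u ∈ C) (hx : x ∈ C)
    (hlam : ∀ n, 1 ≤ n → lam n ∈ Set.Icc (0 : ℝ) 1)
    (hlam' : ∀ n, 2 ≤ n → lam n ∈ Set.Ioo (0 : ℝ) 1) {M : ℕ} (hM : 1 ≤ M)
    (hdist : ∀ y ∈ C, ∀ z ∈ C, dist y z ≤ M) {α β θ : ℝ → ℕ} {D : ℝ → ℝ} {Dk : ℕ → ℝ → ℝ}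
    (hα : IsRateOfConvergence α lam 0) (hβ : IsCauchyModulus β (varSeq lam))
    (hθ : IsRateOfConvergence θ (prodSeq lam) 0)
    (hD : ∀ δ > 0, 0 < D δ ∧ D δ ≤ prodSeq lam (β (δ / (4 * M))))
    (hDk : ∀ k : ℕ, ∀ δ > 0, 0 < Dk k δ ∧
      Dk k δ ≤ prodSeq lam (chiStar M θ α D k (δ / 3) - 1))
    {ε : ℝ} (hε0 : 0 < ε) (hε2 : ε < 2) (g : ℕ → ℕ) :
    ∃ N ≤ Sigma M θ α D Dk ε g, ∀ m ∈ Set.Icc N (N + g N), ∀ n ∈ Set.Icc N (N + g N),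
      dist (halpern T lam u x m) (halpern T lam u x n) ≤ ε := by
  have hM' : (1 : ℝ) ≤ M := by exact_mod_cast hM
  have hmem := halpern_mem hconv hTC hu hx hlam
  have htk : ∀ k : ℕ, 0 < 1 / ((k : ℝ) + 1) ∧ 1 / ((k : ℝ) + 1) ≤ 1 := fun k =>
    ⟨Nat.one_div_pos_of_nat, by
      rw [div_le_one (by positivity)]; linarith [Nat.cast_nonneg (α := ℝ) k]⟩
  choose z hzC hz using fun k : ℕ =>
    exists_resolvent hC hconv hTC hT hu (htk k).1 (htk k).2
  have hmono : Monotone fun k => dist u (z k) ^ 2 := fun i j hij =>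
    dist_sq_resolvent_mono (htk j).1 (Nat.one_div_le_one_div hij) (htk i).2 (hz i) (hz j)
      (hT _ (hzC i) _ (hzC j))
  have he0 : 0 < eps0 M ε := by unfold eps0; positivity
  have he0_le : eps0 M ε ^ 2 ≤ ε ^ 2 / 24 := by
    have h1 : eps0 M ε ≤ ε ^ 2 / 24 := by
      unfold eps0
      exact div_le_div_of_nonneg_left (sq_nonneg _) (by norm_num) (by nlinarith)
    have h2 : ε ^ 2 / 24 ≤ 1 := by nlinarith
    nlinarith
  obtain ⟨i, hi, hgap⟩ := exists_iterate_sub_le (a := fun k => dist u (z k) ^ 2)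
    (B := (M : ℝ) ^ 2) (δ := eps0 M ε ^ 2) (fun k => sq_nonneg _)
    (fun k => pow_le_pow_left₀ dist_nonneg (hdist _ hu _ (hzC k)) 2) (fStarTilde M θ α D Dk g ε)
    (n := ⌈(M : ℝ) ^ 2 / eps0 M ε ^ 2⌉₊) (Nat.ceil_pos.2 (by positivity))
    ((div_le_iff₀ (by positivity)).1 (Nat.le_ceil _))
  rw [Function.iterate_succ_apply'] at hgap
  set K := (fStarTilde M θ α D Dk g ε)^[i] 0 with hK
  set k := K + ⌈1 / eps0 M ε⌉₊ with hk
  set δ := ε ^ 2 / 4 with hδdef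
  set j := max ⌈(M : ℝ) ^ 2 / DeltaStar M θ α D Dk g k δ⌉₊ k with hj
  -- Since k ≤ j, the truncated subtraction in `f` is exact; the two shifts by ⌈1/ε₀⌉ carry K to k
  -- and complete the sum to j.
  have hhK : fStarTilde M θ α D Dk g ε K = j := by
    have : k ≤ j := le_max_right _ _
    unfold fStarTilde fStar fFun
    rw [← hk, ← hδdef, ← hj]
    omega
  have hKn : K ≤ (fStarTilde M θ α D Dk g ε)^[⌈(M : ℝ) ^ 2 / eps0 M ε ^ 2⌉₊] 0 :=
    Function.monotone_iterate_of_id_le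
      (fun q => Nat.le_add_right q (fStar M θ α D Dk g ε q)) hi.le 0
  have hjk : dist u (z j) ^ 2 ≤ dist u (z k) ^ 2 + eps0 M ε ^ 2 := by
    have : dist u (z K) ^ 2 ≤ dist u (z k) ^ 2 := hmono (Nat.le_add_right K _)
    rw [hhK] at hgap
    linarith
  have hδ0 : 0 < δ := by positivity
  have hδ1 : δ < 1 := by rw [hδdef]; nlinarith
  obtain ⟨hDk0, hDk1⟩ := hDk k δ hδ0
  have hχΘ := chiStar_lt_Theta hlam' hM hθ hδ0 hδ1 hDk0 hDk1
  set χ := chiStar M θ α D k (δ / 3) with hχ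
  have hχ1 : 1 ≤ χ := chiStar_pos _ _ _ _ _ _
  set N := Theta M θ Dk k δ with hN
  have hN_le : N ≤ Sigma M θ α D Dk ε g :=
    Finset.le_sup (f := fun k => Theta M θ Dk k (ε ^ 2 / 4))
      (Finset.mem_Icc.2 ⟨by omega, by omega⟩)
  -- the iterates are almost as far from `u` as `z j`
  have hfar : ∀ n ≥ χ, dist u (z j) ^ 2 ≤ dist u (halpern T lam u x n) ^ 2 + δ / 3 := by
    intro n hn
    have h0 : 0 < δ / 3 / (24 * M * (k + 1)) := by positivity
    have h1 := dist_halpern_map_le hconv hTC hT hu hx hlam hlam' hM hdist hα hβ hθ hD h0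
      ((Phi_le_chiStar M hM θ α D k (by positivity) (by linarith)).trans hn)
    have h2 := mul_dist_sq_resolvent_le (htk k).1 (htk k).2 (hz k)
      (hT _ (hzC k) _ (hmem n)) (hdist _ (hzC k) _ (hmem n)) (hdist _ (hmem n) _ (hTC (hmem n)))
    have h3 : 3 * M * (δ / 3 / (24 * M * (k + 1))) = 1 / ((k : ℝ) + 1) * (δ / 24) := by
      field_simp
    have h4 : dist u (z k) ^ 2 ≤ dist u (halpern T lam u x n) ^ 2 + δ / 24 := by
      refine le_of_mul_le_mul_left ?_ (htk k).1
      have := mul_le_mul_of_nonneg_left h1 (by positivity : (0 : ℝ) ≤ 3 * M)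
      linarith
    -- The total error is δ/24 + ε₀² ≤ δ/24 + δ/6 < δ/3.
    have h5 : ε ^ 2 = 4 * δ := by rw [hδdef]; ring
    linarith
  have hnear : ∀ n ∈ Set.Icc N (N + g N), dist (halpern T lam u x n) (z j) ≤ ε / 2 := by
    intro n hn
    obtain ⟨q, rfl⟩ : ∃ q, n = χ - 1 + q + 1 := ⟨n - χ, by have := hn.1; omega⟩
    set t := 1 / ((j : ℝ) + 1) with ht
    have htM : 0 ≤ t * (M : ℝ) ^ 2 := mul_nonneg (htk j).1.le (sq_nonneg _)
    -- Subtracting δ/3 absorbs the term λ δ/3. What remains is three errors of δ/3: initial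
    -- distance, excess and drift.
    have h1 := prodSeq_mul_le (m := χ - 1) hlam'
      (s := fun n => dist (halpern T lam u x (n + 1)) (z j) ^ 2 - δ / 3)
      (W := fun n => n * (t * (M : ℝ) ^ 2))
      (fun a b hab => mul_le_mul_of_nonneg_right (by exact_mod_cast hab) htM)
      (fun n hn' => by
        have := dist_sq_halpern_succ_le hlam (htk j).1 (htk j).2 (hz j) (n + 1)
          (hT _ (hmem (n + 1)) _ (hzC j)) (hdist _ hu _ (hTC (hmem (n + 1))))
          (hfar (n + 2) (by omega))
        push_cast
        linarith) q
    have hPχ := prodSeq_pos hlam' (χ - 1)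
    have hP : prodSeq lam (χ - 1 + q) * (M : ℝ) ^ 2 ≤ prodSeq lam (χ - 1) * (δ / 3) := by
      -- From N = θ(…) + 1 ≤ χ - 1 + q + 1 the index χ - 1 + q is already in the range of θ.
      have h2 := (hθ (Dk k δ * δ / (3 * (M : ℝ) ^ 2)) (by positivity)).2 (χ - 1 + q)
        (by have := hn.1; rw [hN] at this; unfold Theta at this; omega)
      rw [sub_zero] at h2
      have h3 := mul_le_mul_of_nonneg_right ((le_abs_self _).trans h2) (sq_nonneg (M : ℝ))
      have h4 : Dk k δ * δ / (3 * (M : ℝ) ^ 2) * (M : ℝ) ^ 2 = Dk k δ * (δ / 3) := by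
        field_simp
      have h5 := mul_le_mul_of_nonneg_right hDk1 (by linarith : 0 ≤ δ / 3)
      linarith
    have hstart : dist (halpern T lam u x (χ - 1 + 1)) (z j) ^ 2 ≤ (M : ℝ) ^ 2 :=
      pow_le_pow_left₀ dist_nonneg (hdist _ (hmem _) _ (hzC j)) 2
    -- At most G = N - χ + g N drift steps occur, and j + 1 ≥ 3 G M²/δ.
    have herr : q * (t * (M : ℝ) ^ 2) ≤ δ / 3 := by
      set G := gShift M θ α D g δ k (N - χ) with hG
      have hqG : q ≤ G := by
        rw [hG]
        unfold gShift
        rw [← hχ, Nat.sub_add_cancel hχΘ.le]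
        have := hn.2
        omega
      have hG0 : 0 < G := by
        rw [hG]
        unfold gShift
        omega
      have hG0' : (0 : ℝ) < G := by exact_mod_cast hG0
      have hqG' : (q : ℝ) ≤ G := by exact_mod_cast hqG
      have hΔ : DeltaStar M θ α D Dk g k δ = δ / (3 * G) := rfl
      have h2 : (M : ℝ) ^ 2 / (δ / (3 * G)) ≤ j + 1 := by
        rw [← hΔ]
        have h3 := (Nat.le_ceil _).trans (Nat.cast_le (α := ℝ).2
          (le_max_left ⌈(M : ℝ) ^ 2 / DeltaStar M θ α D Dk g k δ⌉₊ k))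
        rw [← hj] at h3
        linarith
      rw [div_le_iff₀ (by positivity)] at h2
      have h3 : t * (M : ℝ) ^ 2 ≤ δ / (3 * G) := by
        rw [ht, one_div, inv_mul_le_iff₀ (by positivity)]
        exact h2
      calc q * (t * (M : ℝ) ^ 2) ≤ G * (δ / (3 * G)) := mul_le_mul hqG' h3 htM hG0'.le
        _ = δ / 3 := by field_simp
    have h6 : dist (halpern T lam u x (χ - 1 + q + 1)) (z j) ^ 2 ≤ δ := by
      have h7 := mul_le_mul_of_nonneg_left hstart (prodSeq_pos hlam' (χ - 1 + q)).le
      have h8 := mul_le_mul_of_nonneg_left herr hPχ.le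
      have h9 := mul_nonneg (prodSeq_pos hlam' (χ - 1 + q)).le (by linarith : 0 ≤ δ / 3)
      refine le_of_mul_le_mul_left ?_ hPχ
      push_cast at h1
      linarith
    refine le_of_sq_le_sq (h6.trans_eq ?_) (by linarith)
    rw [hδdef]; ring
  refine ⟨N, hN_le, fun m hm n hn => ?_⟩
  have := dist_triangle_right (halpern T lam u x m) (halpern T lam u x n) (z j)
  linarith [hnear m hm, hnear n hn]

end Iteration

/-! ### From metastability to convergence -/

/-- If the sequence is not Cauchy, every N has some n N ≥ N with d(s (n N), s N) ≥ ε; the window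
length n N - N captures this pair. -/
theorem cauchySeq_of_metastable {X : Type*} [PseudoMetricSpace X] {s : ℕ → X}
    (h : ∀ ε : ℝ, 0 < ε → ε < 2 → ∀ g : ℕ → ℕ, ∃ N, ∀ m ∈ Set.Icc N (N + g N),
      ∀ n ∈ Set.Icc N (N + g N), dist (s m) (s n) ≤ ε) : CauchySeq s := by
  refine Metric.cauchySeq_iff'.2 fun ε hε => ?_
  by_contra! hcon
  choose n hn hd using hcon
  obtain ⟨N, hN⟩ := h (min ε 1 / 2) (by positivity) (by linarith [min_le_right ε 1])
    (fun N => n N - N)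
  have h1 := hN (n N) ⟨hn N, by have := hn N; omega⟩ N ⟨le_rfl, by omega⟩
  linarith [hd N, min_le_left ε 1]

theorem exists_isRateOfConvergence {s : ℕ → ℝ} {a : ℝ}
    (h : Filter.Tendsto s Filter.atTop (nhds a)) : ∃ γ, IsRateOfConvergence γ s a := by
  have : ∀ ε : ℝ, ∃ n : ℕ, 0 < ε → 1 ≤ n ∧ ∀ m ≥ n, |s m - a| ≤ ε := by
    intro ε
    by_cases hε : 0 < ε
    · obtain ⟨n, hn⟩ := Metric.tendsto_atTop.1 h ε hε
      exact ⟨max n 1, fun _ => ⟨le_max_right _ _, fun m hm =>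
        (hn m ((le_max_left _ _).trans hm)).le⟩⟩
    · exact ⟨0, fun h => absurd h hε⟩
  choose γ hγ using this
  exact ⟨γ, hγ⟩

theorem exists_isCauchyModulus {s : ℕ → ℝ} {a : ℝ}
    (h : Filter.Tendsto s Filter.atTop (nhds a)) : ∃ γ, IsCauchyModulus γ s := by
  obtain ⟨γ, hγ⟩ := exists_isRateOfConvergence h
  refine ⟨fun ε => γ (ε / 2), fun ε hε => ⟨(hγ _ (half_pos hε)).1, fun n => ?_⟩⟩
  have h1 := abs_le.1 ((hγ _ (half_pos hε)).2 _ (Nat.le_add_right _ n))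
  have h2 := abs_le.1 ((hγ _ (half_pos hε)).2 _ le_rfl)
  linarith [h1.2, h2.1]

end HalpernCAT0

theorem theorem4p3 {X : Type*} [MetricSpace X] [CompleteSpace X] [HalpernCAT0.CAT0Space X]
    (C : Set X) (hCclosed : IsClosed C) (hCbdd : Bornology.IsBounded C)
    (hCconv : HalpernCAT0.IsConvexSubset C)
    (T : X → X) (hTC : Set.MapsTo T C C)
    (hT : ∀ y ∈ C, ∀ z ∈ C, dist (T y) (T z) ≤ dist y z)
    (u x : X) (hu : u ∈ C) (hx : x ∈ C)
    (lam : ℕ → ℝ) (hlam : ∀ n, 1 ≤ n → lam n ∈ Set.Icc (0 : ℝ) 1)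
    (hlam' : ∀ n, 2 ≤ n → lam n ∈ Set.Ioo (0 : ℝ) 1)
    (hC1 : Filter.Tendsto lam Filter.atTop (nhds 0))
    (hC2 : ∃ s : ℝ, Filter.Tendsto (HalpernCAT0.varSeq lam) Filter.atTop (nhds s))
    (hC4 : Filter.Tendsto (HalpernCAT0.prodSeq lam) Filter.atTop (nhds 0)) :
    CauchySeq (HalpernCAT0.halpern T lam u x) ∧
    ∀ (M : ℕ) (α β θ : ℝ → ℕ) (D : ℝ → ℝ) (Dk : ℕ → ℝ → ℝ),
      1 ≤ M → Metric.diam C ≤ M →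
      HalpernCAT0.IsRateOfConvergence α lam 0 →
      HalpernCAT0.IsCauchyModulus β (HalpernCAT0.varSeq lam) →
      HalpernCAT0.IsRateOfConvergence θ (HalpernCAT0.prodSeq lam) 0 →
      (∀ δ > 0, 0 < D δ ∧ D δ ≤ HalpernCAT0.prodSeq lam (β (δ / (4 * M)))) →
      (∀ k : ℕ, ∀ δ > 0, 0 < Dk k δ ∧
        Dk k δ ≤ HalpernCAT0.prodSeq lam (HalpernCAT0.chiStar M θ α D k (δ / 3) - 1)) →
      ∀ ε : ℝ, 0 < ε → ε < 2 → ∀ g : ℕ → ℕ,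
        ∃ N ≤ HalpernCAT0.Sigma M θ α D Dk ε g,
          ∀ m ∈ Set.Icc N (N + g N), ∀ n ∈ Set.Icc N (N + g N),
            dist (HalpernCAT0.halpern T lam u x m) (HalpernCAT0.halpern T lam u x n) ≤ ε := by

  have hmain : ∀ (M : ℕ) (α β θ : ℝ → ℕ) (D : ℝ → ℝ) (Dk : ℕ → ℝ → ℝ),
      1 ≤ M → Metric.diam C ≤ M →
      HalpernCAT0.IsRateOfConvergence α lam 0 →
      HalpernCAT0.IsCauchyModulus β (HalpernCAT0.varSeq lam) →
      HalpernCAT0.IsRateOfConvergence θ (HalpernCAT0.prodSeq lam) 0 →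
      (∀ δ > 0, 0 < D δ ∧ D δ ≤ HalpernCAT0.prodSeq lam (β (δ / (4 * M)))) →
      (∀ k : ℕ, ∀ δ > 0, 0 < Dk k δ ∧
        Dk k δ ≤ HalpernCAT0.prodSeq lam (HalpernCAT0.chiStar M θ α D k (δ / 3) - 1)) →
      ∀ ε : ℝ, 0 < ε → ε < 2 → ∀ g : ℕ → ℕ,
        ∃ N ≤ HalpernCAT0.Sigma M θ α D Dk ε g,
          ∀ m ∈ Set.Icc N (N + g N), ∀ n ∈ Set.Icc N (N + g N),
            dist (HalpernCAT0.halpern T lam u x m) (HalpernCAT0.halpern T lam u x n) ≤ ε :=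
    fun M α β θ D Dk hM hdiam hα hβ hθ hD hDk ε hε0 hε2 g =>
      HalpernCAT0.halpern_metastable hCclosed hCconv hTC hT hu hx hlam hlam' hM
        (fun y hy z hz => (Metric.dist_le_diam_of_mem hCbdd hy hz).trans hdiam)
        hα hβ hθ hD hDk hε0 hε2 g
  refine ⟨?_, hmain⟩
  obtain ⟨α, hα⟩ := HalpernCAT0.exists_isRateOfConvergence hC1
  obtain ⟨θ, hθ⟩ := HalpernCAT0.exists_isRateOfConvergence hC4
  obtain ⟨β, hβ⟩ := hC2.elim fun s hs => HalpernCAT0.exists_isCauchyModulus hs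
  have hpos := HalpernCAT0.prodSeq_pos hlam'
  refine HalpernCAT0.cauchySeq_of_metastable fun ε hε0 hε2 g => ?_
  -- The products are positive, so they can themselves serve as `D` and `Dk`.
  obtain ⟨N, -, hN⟩ := hmain (max 1 ⌈Metric.diam C⌉₊) α β θ _ _ (le_max_left _ _)
    ((Nat.le_ceil _).trans (Nat.cast_le.2 (le_max_right _ _))) hα hβ hθ
    (fun δ _ => ⟨hpos _, le_rfl⟩) (fun k δ _ => ⟨hpos _, le_rfl⟩) ε hε0 hε2 g
  exact ⟨N, hN⟩
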